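/- Let $C=C[0,1]$ be the Banach space of continuous functions $x:[0,1]\to\mathbb R$ with the maximum norm, and let $L=L_1[0,1]$ be the Banach space of (classes of) Lebesgue integrable functions on $[0,1]$ with the norm $\|f\|_L=\int_0^1|f(s)|\,ds$. A linear bounded operator $C\to L$ is called positive if it maps nonnegative functions to almost everywhere nonnegative functions. Let $k<0$. Let $D_-$ be the set of all functions $x:(0,1]\to\mathbb R$ that are absolutely continuous on $[\varepsilon,1]$ for every $\varepsilon\in(0,1)$ and satisfy, for some $f\in L$, the equation $\dot x(t)=-\frac{k}{t}x(t)+f(t)$ for almost all $t\in(0,1]$; every such function has a finite limit at $t=0+$, and the elements of $D_-$ are regarded as extended by continuity to $[0,1]$, so that $D_-\subset C$. For a linear bounded operator $T:C\to L$ consider the problem $$\dot x(t)=-\frac{k}{t}\,x(t)+(Tx)(t)+f(t)\ \text{ for almost all } t\in[0,1],\qquad x(1)=c. \tag{1}$$ Problem (1) is called uniquely solvable in $D_-$ if for every $f\in L$ and every $c\in\mathbb R$ there is exactly one $x\in D_-$ that satisfies (1). **Theorem.** Let $k<0$ and let nonnegative numbers $\mathcal T^+$, $\mathcal T^-$ be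 given. Problem (1) is uniquely solvable in $D_-$ for all operators $T=T^+-T^-$ such that $T^+,T^-:C\to L$ are linear positive operators with $$\|T^+\|_{C\to L}=\mathcal T^+,\qquad \|T^-\|_{C\to L}=\mathcal T^-$$ if and only if $$\mathcal T^-\le 1\quad\text{and}\quad \mathcal T^+\le 2\sqrt{1-\mathcal T^-}.$$ -/

import Mathlib

open MeasureTheory

noncomputable section

/-- The Banach space `C = C[0,1]` of continuous real functions, with the maximum norm. -/
abbrev SpaceC : Type := C(Set.Icc (0 : ℝ) 1, ℝ)

/-- Lebesgue measure on `[0,1]`. -/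
abbrev lebesgue01 : Measure ℝ := volume.restrict (Set.Icc (0 : ℝ) 1)

/-- The Banach space `L = L₁[0,1]`. -/
abbrev SpaceL : Type := Lp ℝ 1 lebesgue01

/-- A function of `C[0,1]` read as a function of a real variable (constant outside `[0,1]`);
only its values on `[0,1]` matter below. -/
def SpaceC.onReal (x : SpaceC) : ℝ → ℝ :=
  Set.IccExtend (zero_le_one : (0 : ℝ) ≤ 1) x

/-- `x` is absolutely continuous on every `[ε,1]` with `0 < ε < 1`. -/
def LocallyAC (x : ℝ → ℝ) : Prop :=
  ∀ ε : ℝ, 0 < ε → ε < 1 → AbsolutelyContinuousOnInterval x ε 1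

/-- `x` is a solution of the model equation `x'(t) = -(k/t) x(t) + f(t)`, `t ∈ (0,1]`: it is locally
absolutely continuous on `(0,1]` and satisfies the equation almost everywhere. -/
def IsModelSolution (k : ℝ) (f : SpaceL) (x : ℝ → ℝ) : Prop :=
  LocallyAC x ∧ ∀ᵐ t ∂lebesgue01, HasDerivAt x (-(k / t) * x t + f t) t

/-- The space `D₋` (for `k < 0`): all solutions of the model equation, for all right-hand sides
in `L`, extended by continuity at `t = 0`. -/
def spaceDMinus (k : ℝ) : Set SpaceC :=
  {x | ∃ f : SpaceL, IsModelSolution k f x.onReal}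

/-- `T : C → L` is positive: it maps nonnegative functions to almost everywhere nonnegative
functions. -/
def IsPositiveOperator (T : SpaceC →L[ℝ] SpaceL) : Prop :=
  ∀ x : SpaceC, (∀ t, 0 ≤ x t) → ∀ᵐ t ∂lebesgue01, 0 ≤ (T x) t

/-- `x` is a solution in `D₋` of the problem
`x'(t) = -(k/t) x(t) + (T x)(t) + f(t)` for almost all `t ∈ [0,1]`, `x(1) = c`. -/
def IsSolution (k : ℝ) (T : SpaceC →L[ℝ] SpaceL) (f : SpaceL) (c : ℝ) (x : SpaceC) : Prop :=
  x ∈ spaceDMinus k ∧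
    (∀ᵐ t ∂lebesgue01, HasDerivAt x.onReal (-(k / t) * x.onReal t + (T x) t + f t) t) ∧
    x.onReal 1 = c

/-- The problem is uniquely solvable in `D₋`: for all `f ∈ L` and `c ∈ ℝ` it has exactly one
solution in `D₋`. -/
def IsUniquelySolvable (k : ℝ) (T : SpaceC →L[ℝ] SpaceL) : Prop :=
  ∀ (f : SpaceL) (c : ℝ), ∃! x : SpaceC, IsSolution k T f c x

end

noncomputable section

open Filter Topology Set

/-! Put κ = -k > 0. The integrating factor t^(-κ) turns the problem into x + G(Tx) = c t^κ - Gf,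
where (Gf)(t) = ∫ₜ¹ (t/s)^κ f(s) ds has kernel in [0,1). For positive T the operator GT is compact
and ‖T‖ = ∫ T1, so by the Fredholm alternative it suffices to study x = -GTx. The condition on the
norms reads τ⁺²/4 + τ⁻ ≤ 1.

Sufficiency: a nonzero solution of constant sign is excluded at the maximum of |x| because the
kernel is below 1 (`eq_zero_of_nonneg_of_add_green_eq_zero`). Otherwise let M > 0 and -m < 0 be its
extremes, with M attained first (else take -x). Let pᵢ, qᵢ be the masses of T⁺1, T⁻1 between the two
extremal points (i = 1) and beyond the second (i = 2). Then M < m p₁ + M q₁ and m ≤ M p₂ + m q₂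
(`exists_split_of_max_lt_min`). Eliminating m and M contradicts the condition, since p₁p₂ ≤ τ⁺²/4
(`false_of_split_inequalities`).

Necessity: operators built from two point evaluations and two bumps nearly attain these
inequalities. Scaling them produces an exact nonzero homogeneous solution
(`exists_not_isUniquelySolvable`). -/

/-! ### Green kernel and Green operator -/

/-- The Green kernel of `x' = κ x / t + f` with terminal condition `x 1 = 0`, up to sign. -/
def greenKernel (κ t s : ℝ) : ℝ := if t < s then (t / s) ^ κ else 0

theorem greenKernel_nonneg (κ : ℝ) {t : ℝ} (ht : 0 ≤ t) (s : ℝ) : 0 ≤ greenKernel κ t s := by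
  unfold greenKernel
  split_ifs with h
  · exact Real.rpow_nonneg (div_nonneg ht (ht.trans h.le)) _
  · exact le_rfl

theorem greenKernel_lt_one {κ : ℝ} (hκ : 0 < κ) {t : ℝ} (ht : 0 ≤ t) (s : ℝ) :
    greenKernel κ t s < 1 := by
  unfold greenKernel
  split_ifs with h
  · have hs : 0 < s := ht.trans_lt h
    exact Real.rpow_lt_one (div_nonneg ht hs.le) ((div_lt_one hs).2 h) hκ
  · exact one_pos

theorem abs_greenKernel_le_one {κ : ℝ} (hκ : 0 < κ) {t : ℝ} (ht : 0 ≤ t) (s : ℝ) :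
    |greenKernel κ t s| ≤ 1 := by
  rw [abs_of_nonneg (greenKernel_nonneg κ ht s)]
  exact (greenKernel_lt_one hκ ht s).le

theorem measurable_greenKernel (κ t : ℝ) : Measurable (greenKernel κ t) :=
  Measurable.ite measurableSet_Ioi (by fun_prop) measurable_const

/-- The only jump is across s = t, a null set of s, so dominated convergence applies to integrals
against the kernel. Positivity of κ covers t = 0. -/
theorem continuousAt_greenKernel {κ : ℝ} (hκ : 0 < κ) {t s : ℝ} (h : s ≠ t) :
    ContinuousAt (fun t => greenKernel κ t s) t := by
  rcases h.lt_or_gt with h | h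
  · refine (continuousAt_const (y := (0 : ℝ))).congr ?_
    filter_upwards [lt_mem_nhds h] with u hu
    simp [greenKernel, hu.le]
  · refine ContinuousAt.congr (f := fun t => (t / s) ^ κ) ?_ ?_
    · exact ContinuousAt.rpow_const (by fun_prop) (Or.inr hκ.le)
    · filter_upwards [gt_mem_nhds h] with u hu
      simp [greenKernel, hu]

theorem ae_ne_lebesgue01 (t : ℝ) : ∀ᵐ s ∂lebesgue01, s ≠ t :=
  Measure.ae_ne _ t

theorem integrable_greenKernel_mul {κ : ℝ} (hκ : 0 < κ) {t : ℝ} (ht : 0 ≤ t) (f : SpaceL) :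
    Integrable (fun s => greenKernel κ t s * f s) lebesgue01 := by
  refine (L1.integrable_coeFn f).bdd_mul (c := 1)
    (measurable_greenKernel κ t).aestronglyMeasurable ?_
  exact Eventually.of_forall fun s => by
    simpa using abs_greenKernel_le_one hκ ht s

theorem continuous_integral_greenKernel {κ : ℝ} (hκ : 0 < κ) (f : SpaceL) :
    Continuous fun t : Icc (0 : ℝ) 1 => ∫ s, greenKernel κ t s * f s ∂lebesgue01 := by
  refine continuous_iff_continuousAt.2 fun t => ?_
  refine continuousAt_of_dominated (bound := fun s => |f s|) ?_ ?_
    (L1.integrable_coeFn f).abs ?_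
  · exact Eventually.of_forall fun u =>
      (integrable_greenKernel_mul hκ u.2.1 f).aestronglyMeasurable
  · refine Eventually.of_forall fun u => Eventually.of_forall fun s => ?_
    rw [Real.norm_eq_abs, abs_mul]
    exact mul_le_of_le_one_left (abs_nonneg _) (abs_greenKernel_le_one hκ u.2.1 s)
  · filter_upwards [ae_ne_lebesgue01 t] with s hs
    exact (((continuousAt_greenKernel hκ hs).comp
      (continuous_subtype_val.continuousAt (x := t))).mul continuousAt_const)

/-- With f = T1 this integral is a modulus of continuity common to all G(Tx), ‖x‖ ≤ 1. -/
theorem continuous_integral_abs_greenKernel_sub {κ : ℝ} (hκ : 0 < κ) (f : SpaceL)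
    (t₀ : Icc (0 : ℝ) 1) :
    ContinuousAt (fun t : Icc (0 : ℝ) 1 =>
      ∫ s, |greenKernel κ t s - greenKernel κ t₀ s| * f s ∂lebesgue01) t₀ := by
  refine continuousAt_of_dominated (bound := fun s => 2 * |f s|) ?_ ?_
    ((L1.integrable_coeFn f).abs.const_mul 2) ?_
  · exact Eventually.of_forall fun u =>
      (((measurable_greenKernel κ u).sub (measurable_greenKernel κ t₀)).abs).aestronglyMeasurable.mul
        (L1.integrable_coeFn f).aestronglyMeasurable
  · refine Eventually.of_forall fun u => Eventually.of_forall fun s => ?_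
    rw [Real.norm_eq_abs, abs_mul, abs_abs]
    refine mul_le_mul_of_nonneg_right ?_ (abs_nonneg _)
    refine (abs_sub _ _).trans ?_
    linarith [abs_greenKernel_le_one hκ u.2.1 s, abs_greenKernel_le_one hκ t₀.2.1 s]
  · filter_upwards [ae_ne_lebesgue01 t₀] with s hs
    exact ((((continuousAt_greenKernel hκ hs).comp
      (continuous_subtype_val.continuousAt (x := t₀))).sub continuousAt_const).abs).mul
        continuousAt_const

theorem norm_spaceL_eq (f : SpaceL) : ‖f‖ = ∫ s, |f s| ∂lebesgue01 := by
  simpa using L1.norm_eq_integral_norm f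

/-- The Green operator `(G f)(t) = ∫ₜ¹ (t/s)^κ f(s) ds`. -/
def greenOperator (κ : ℝ) (hκ : 0 < κ) : SpaceL →L[ℝ] SpaceC :=
  LinearMap.mkContinuous
    { toFun := fun f => ⟨fun t => ∫ s, greenKernel κ t s * f s ∂lebesgue01,
        continuous_integral_greenKernel hκ f⟩
      map_add' := fun f g => by
        ext t
        simp only [ContinuousMap.coe_mk, ContinuousMap.add_apply]
        rw [← integral_add (integrable_greenKernel_mul hκ t.2.1 f)
          (integrable_greenKernel_mul hκ t.2.1 g)]
        refine integral_congr_ae ?_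
        filter_upwards [Lp.coeFn_add f g] with s hs
        rw [hs, Pi.add_apply, mul_add]
      map_smul' := fun c f => by
        ext t
        simp only [ContinuousMap.coe_mk, ContinuousMap.smul_apply, RingHom.id_apply, smul_eq_mul]
        rw [← integral_const_mul]
        refine integral_congr_ae ?_
        filter_upwards [Lp.coeFn_smul c f] with s hs
        rw [hs, Pi.smul_apply, smul_eq_mul]
        ring }
    1 (fun f => by
      rw [one_mul, ContinuousMap.norm_le _ (norm_nonneg f)]
      intro t
      rw [norm_spaceL_eq]
      refine norm_integral_le_of_norm_le (L1.integrable_coeFn f).abs (Eventually.of_forall fun s => ?_)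
      rw [Real.norm_eq_abs, abs_mul]
      exact mul_le_of_le_one_left (abs_nonneg _) (abs_greenKernel_le_one hκ t.2.1 s))

theorem greenOperator_apply {κ : ℝ} (hκ : 0 < κ) (f : SpaceL) (t : Icc (0 : ℝ) 1) :
    greenOperator κ hκ f t = ∫ s, greenKernel κ t s * f s ∂lebesgue01 := rfl

/-- The power `t ↦ t ^ κ` as an element of `C[0,1]`. -/
def powerC (κ : ℝ) (hκ : 0 < κ) : SpaceC :=
  ⟨fun t => (t : ℝ) ^ κ, continuous_subtype_val.rpow_const fun _ => Or.inr hκ.le⟩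

theorem greenOperator_zero {κ : ℝ} (hκ : 0 < κ) (f : SpaceL) :
    greenOperator κ hκ f 0 = 0 := by
  rw [greenOperator_apply]
  refine integral_eq_zero_of_ae (Eventually.of_forall fun s => ?_)
  simp [greenKernel, Real.zero_rpow hκ.ne']

theorem greenOperator_one {κ : ℝ} (hκ : 0 < κ) (f : SpaceL) :
    greenOperator κ hκ f 1 = 0 := by
  rw [greenOperator_apply]
  refine integral_eq_zero_of_ae ?_
  filter_upwards [ae_restrict_mem measurableSet_Icc] with s hs
  simp [greenKernel, hs.2.not_gt]

/-! ### Reduction to an integral equation -/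

theorem greenOperator_eq_intervalIntegral {κ : ℝ} (hκ : 0 < κ) (f : SpaceL) {t : ℝ}
    (ht : t ∈ Ioc (0 : ℝ) 1) :
    greenOperator κ hκ f ⟨t, ht.1.le, ht.2⟩ = t ^ κ * ∫ s in t..1, s ^ (-κ) * f s := by
  rw [greenOperator_apply, intervalIntegral.integral_of_le ht.2, ← integral_const_mul]
  have h1 : ∀ s, greenKernel κ t s * f s
      = (Ioi t).indicator (fun s => (t / s) ^ κ * f s) s := fun s => by
    by_cases h : t < s <;> simp [greenKernel, h]
  simp only [h1]
  rw [integral_indicator measurableSet_Ioi, Measure.restrict_restrict measurableSet_Ioi]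
  have h2 : Ioi t ∩ Icc 0 1 = Ioc t 1 := by
    ext s
    simp only [mem_inter_iff, mem_Ioi, mem_Icc, mem_Ioc]
    constructor
    · rintro ⟨a, b, c⟩; exact ⟨a, c⟩
    · rintro ⟨a, b⟩; exact ⟨a, (ht.1.trans a).le, b⟩
  rw [h2]
  refine setIntegral_congr_fun measurableSet_Ioc fun s hs => ?_
  have hs0 : 0 < s := ht.1.trans hs.1
  rw [Real.div_rpow ht.1.le hs0.le, Real.rpow_neg hs0.le]
  ring

theorem intervalIntegrable_rpow_neg_mul (κ : ℝ) (f : SpaceL) {ε : ℝ} (hε : 0 < ε) (hε1 : ε ≤ 1) :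
    IntervalIntegrable (fun s => s ^ (-κ) * f s) volume ε 1 := by
  have hf : IntervalIntegrable f volume ε 1 := by
    rw [intervalIntegrable_iff_integrableOn_Icc_of_le hε1]
    exact IntegrableOn.mono_set (L1.integrable_coeFn f) (Icc_subset_Icc_left hε.le)
  refine hf.continuousOn_mul ?_
  rw [uIcc_of_le hε1]
  exact fun s hs => (Real.continuousAt_rpow_const _ _
    (Or.inl (hε.trans_le hs.1).ne')).continuousWithinAt

theorem absolutelyContinuousOnInterval_rpow (p : ℝ) {ε : ℝ} (hε : 0 < ε) (hε1 : ε ≤ 1) :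
    AbsolutelyContinuousOnInterval (fun s => s ^ p) ε 1 := by
  refine ContDiffOn.absolutelyContinuousOnInterval ?_
  rw [uIcc_of_le hε1]
  exact fun s hs => (Real.contDiffAt_rpow_const_of_ne (hε.trans_le hs.1).ne').contDiffWithinAt

theorem AbsolutelyContinuousOnInterval.congr {f g : ℝ → ℝ} {a b : ℝ}
    (hf : AbsolutelyContinuousOnInterval f a b) (hfg : EqOn f g (uIcc a b)) :
    AbsolutelyContinuousOnInterval g a b := by
  rw [absolutelyContinuousOnInterval_iff] at hf ⊢
  intro ε hε
  obtain ⟨δ, hδ, h⟩ := hf ε hε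
  refine ⟨δ, hδ, fun E hE hlen => ?_⟩
  refine lt_of_eq_of_lt (Finset.sum_congr rfl fun i hi => ?_) (h E hE hlen)
  rw [hfg (hE.1 i hi).1, hfg (hE.1 i hi).2]

theorem SpaceC.onReal_of_mem (x : SpaceC) {t : ℝ} (ht : t ∈ Icc (0 : ℝ) 1) :
    x.onReal t = x ⟨t, ht⟩ :=
  IccExtend_of_mem _ _ ht

theorem SpaceC.onReal_one (x : SpaceC) : x.onReal 1 = x 1 :=
  x.onReal_of_mem ⟨zero_le_one, le_rfl⟩

/-- The derivative of s^(-κ) x(s) is s^(-κ) f(s) almost everywhere. Integrating it over [t,1] gives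
the formula on (0,1), and density with continuity gives the endpoints. -/
theorem IsModelSolution.eq_green {κ : ℝ} (hκ : 0 < κ) {f : SpaceL} {x : SpaceC}
    (hx : IsModelSolution (-κ) f x.onReal) :
    x = x 1 • powerC κ hκ - greenOperator κ hκ f := by
  have key : ∀ t (ht : t ∈ Ioo (0 : ℝ) 1),
      x ⟨t, ht.1.le, ht.2.le⟩ = (x 1 • powerC κ hκ - greenOperator κ hκ f) ⟨t, ht.1.le, ht.2.le⟩ := by
    intro t ht
    have hac := (absolutelyContinuousOnInterval_rpow (-κ) ht.1 ht.2.le).mul (hx.1 t ht.1 ht.2)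
    have hftc := hac.integral_deriv_eq_sub
    have hint : ∫ s in t..1, deriv ((fun s => s ^ (-κ)) * x.onReal) s
        = ∫ s in t..1, s ^ (-κ) * f s := by
      rw [intervalIntegral.integral_of_le ht.2.le, intervalIntegral.integral_of_le ht.2.le]
      refine integral_congr_ae ?_
      have h1 := ae_restrict_of_ae_restrict_of_subset
        (Ioc_subset_Icc_self.trans (Icc_subset_Icc_left ht.1.le) : Ioc t 1 ⊆ Icc 0 1) hx.2
      filter_upwards [h1, ae_restrict_mem measurableSet_Ioc] with s hs hst
      have hs0 : 0 < s := ht.1.trans hst.1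
      have hd := ((Real.hasDerivAt_rpow_const (p := -κ) (Or.inl hs0.ne')).mul hs)
      rw [hd.deriv, Real.rpow_sub_one hs0.ne']
      field_simp
      ring
    rw [hint] at hftc
    simp only [Pi.mul_apply, Real.one_rpow, one_mul, SpaceC.onReal_one] at hftc
    rw [x.onReal_of_mem ⟨ht.1.le, ht.2.le⟩] at hftc
    rw [ContinuousMap.sub_apply, ContinuousMap.smul_apply,
      greenOperator_eq_intervalIntegral hκ f ⟨ht.1, ht.2.le⟩, hftc, Real.rpow_neg ht.1.le]
    have : t ^ κ ≠ 0 := (Real.rpow_pos_of_pos ht.1 κ).ne'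
    simp only [powerC, ContinuousMap.coe_mk, smul_eq_mul]
    field_simp
    ring
  have hd : Dense {t : Icc (0 : ℝ) 1 | (t : ℝ) ∈ Ioo (0 : ℝ) 1} := by
    intro t
    rw [closure_subtype]
    have : ((↑) '' {t : Icc (0 : ℝ) 1 | (t : ℝ) ∈ Ioo (0 : ℝ) 1} : Set ℝ) = Ioo 0 1 := by
      ext s
      constructor
      · rintro ⟨u, hu, rfl⟩; exact hu
      · exact fun hs => ⟨⟨s, hs.1.le, hs.2.le⟩, hs, rfl⟩
    rw [this, closure_Ioo zero_ne_one]
    exact t.2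
  refine ContinuousMap.coe_injective (Continuous.ext_on hd x.continuous
    (ContinuousMap.continuous _) fun t ht => ?_)
  exact key t ht

theorem isModelSolution_green {κ : ℝ} (hκ : 0 < κ) (f : SpaceL) (c : ℝ) :
    IsModelSolution (-κ) f (SpaceC.onReal (c • powerC κ hκ - greenOperator κ hκ f)) := by
  set x : SpaceC := c • powerC κ hκ - greenOperator κ hκ f with hx
  have hrep : ∀ t ∈ Ioc (0 : ℝ) 1,
      x.onReal t = t ^ κ * (c + ∫ s in (1 : ℝ)..t, s ^ (-κ) * f s) := by
    intro t ht
    rw [x.onReal_of_mem ⟨ht.1.le, ht.2⟩, hx, ContinuousMap.sub_apply, ContinuousMap.smul_apply,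
      greenOperator_eq_intervalIntegral hκ f ht, intervalIntegral.integral_symm t 1]
    simp only [powerC, ContinuousMap.coe_mk, smul_eq_mul]
    ring
  constructor
  · intro ε hε hε1
    have hc : AbsolutelyContinuousOnInterval (fun _ : ℝ => c) ε 1 :=
      (contDiff_const.contDiffOn).absolutelyContinuousOnInterval
    refine ((absolutelyContinuousOnInterval_rpow κ hε hε1.le).mul (hc.add
      ((intervalIntegrable_rpow_neg_mul κ f hε hε1.le).absolutelyContinuousOnInterval_intervalIntegral
        (c := 1) right_mem_uIcc))).congr ?_
    intro t ht
    rw [uIcc_of_le hε1.le] at ht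
    exact (hrep t ⟨hε.trans_le ht.1, ht.2⟩).symm
  -- Since s^(-κ) f(s) need not be integrable up to 0, differentiation is done on the intervals
  -- [1/(n+1), 1], which exhaust (0,1].
  · have hae : ∀ᵐ t : ℝ, ∀ n : ℕ, t ∈ uIcc (1 / ((n : ℝ) + 1)) 1 →
        HasDerivAt (fun u => ∫ s in (1 : ℝ)..u, s ^ (-κ) * f s) (t ^ (-κ) * f t) t := by
      rw [ae_all_iff]
      intro n
      have h0 : 0 < 1 / ((n : ℝ) + 1) := by positivity
      have h1 : 1 / ((n : ℝ) + 1) ≤ 1 := by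
        rw [div_le_one (by positivity)]; linarith [n.cast_nonneg (α := ℝ)]
      filter_upwards [(intervalIntegrable_rpow_neg_mul κ f h0 h1).ae_hasDerivAt_integral]
        with t ht htm
      exact ht htm 1 right_mem_uIcc
    filter_upwards [ae_restrict_of_ae hae, ae_ne_lebesgue01 0, ae_ne_lebesgue01 1,
      ae_restrict_mem measurableSet_Icc] with t ht h0 h1 hm
    have ht0 : 0 < t := lt_of_le_of_ne hm.1 h0.symm
    have ht1 : t < 1 := lt_of_le_of_ne hm.2 h1
    obtain ⟨n, hn⟩ := exists_nat_one_div_lt ht0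
    have hI := ht n (by rw [uIcc_of_le (hn.le.trans hm.2)]; exact ⟨hn.le, hm.2⟩)
    have hd := (Real.hasDerivAt_rpow_const (p := κ) (Or.inl ht0.ne')).mul (hI.const_add c)
    have heq : x.onReal =ᶠ[𝓝 t] fun t => t ^ κ * (c + ∫ s in (1 : ℝ)..t, s ^ (-κ) * f s) := by
      filter_upwards [Ioo_mem_nhds ht0 ht1] with u hu
      exact hrep u ⟨hu.1, hu.2.le⟩
    refine (hd.congr_of_eventuallyEq heq).congr_deriv ?_
    rw [hrep t ⟨ht0, hm.2⟩, Real.rpow_sub_one ht0.ne', Real.rpow_neg ht0.le]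
    have : t ^ κ ≠ 0 := (Real.rpow_pos_of_pos ht0 κ).ne'
    field_simp

theorem isSolution_iff {κ : ℝ} (hκ : 0 < κ) (T : SpaceC →L[ℝ] SpaceL) (f : SpaceL) (c : ℝ)
    (x : SpaceC) :
    IsSolution (-κ) T f c x ↔
      x + greenOperator κ hκ (T x) = c • powerC κ hκ - greenOperator κ hκ f := by
  have hadd : ∀ {y : ℝ → ℝ}, (∀ᵐ t ∂lebesgue01, HasDerivAt y (-(-κ / t) * y t + (T x) t + f t) t) ↔
      ∀ᵐ t ∂lebesgue01, HasDerivAt y (-(-κ / t) * y t + (T x + f) t) t := by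
    intro y
    refine eventually_congr ?_
    filter_upwards [Lp.coeFn_add (T x) f] with t ht
    rw [ht, Pi.add_apply, add_assoc]
  have hone : ∀ g : SpaceL, (c • powerC κ hκ - greenOperator κ hκ g) 1 = c := by
    intro g
    rw [ContinuousMap.sub_apply, greenOperator_one]
    simp [powerC]
  constructor
  · rintro ⟨⟨g, hg⟩, hd, h1⟩
    have := IsModelSolution.eq_green hκ (f := T x + f) ⟨hg.1, hadd.1 hd⟩
    rw [x.onReal_one] at h1
    rw [h1, map_add] at this
    nth_rewrite 1 [this]
    abel
  · intro h
    have hx : x = c • powerC κ hκ - greenOperator κ hκ (T x + f) := by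
      rw [map_add, ← sub_sub, sub_right_comm, ← h]
      abel
    have hm := isModelSolution_green hκ (T x + f) c
    rw [← hx] at hm
    refine ⟨⟨_, hm⟩, hadd.2 hm.2, ?_⟩
    rw [x.onReal_one, hx, hone]

/-! ### Positive operators and their norms -/

theorem IsPositiveOperator.mono {T : SpaceC →L[ℝ] SpaceL} (hT : IsPositiveOperator T)
    {x y : SpaceC} (h : ∀ t, x t ≤ y t) : ∀ᵐ s ∂lebesgue01, (T x) s ≤ (T y) s := by
  filter_upwards [hT (y - x) fun t => sub_nonneg.2 (h t), Lp.coeFn_sub (T y) (T x)] with s hs hsub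
  rw [map_sub, hsub, Pi.sub_apply] at hs
  linarith

theorem IsPositiveOperator.le_mul {T : SpaceC →L[ℝ] SpaceL} (hT : IsPositiveOperator T)
    {x : SpaceC} {M : ℝ} (h : ∀ t, x t ≤ M) : ∀ᵐ s ∂lebesgue01, (T x) s ≤ M * (T 1) s := by
  filter_upwards [hT.mono (y := M • (1 : SpaceC)) (by simpa using h),
    Lp.coeFn_smul M (T 1)] with s hs hsmul
  rwa [map_smul, hsmul, Pi.smul_apply, smul_eq_mul] at hs

theorem IsPositiveOperator.mul_le {T : SpaceC →L[ℝ] SpaceL} (hT : IsPositiveOperator T)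
    {x : SpaceC} {M : ℝ} (h : ∀ t, M ≤ x t) : ∀ᵐ s ∂lebesgue01, M * (T 1) s ≤ (T x) s := by
  filter_upwards [hT.mono (x := M • (1 : SpaceC)) (by simpa using h),
    Lp.coeFn_smul M (T 1)] with s hs hsmul
  rwa [map_smul, hsmul, Pi.smul_apply, smul_eq_mul] at hs

theorem IsPositiveOperator.map_one_nonneg {T : SpaceC →L[ℝ] SpaceL} (hT : IsPositiveOperator T) :
    ∀ᵐ s ∂lebesgue01, 0 ≤ (T 1) s :=
  hT 1 fun _ => zero_le_one

theorem IsPositiveOperator.abs_apply_le {T : SpaceC →L[ℝ] SpaceL} (hT : IsPositiveOperator T)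
    (x : SpaceC) : ∀ᵐ s ∂lebesgue01, |(T x) s| ≤ ‖x‖ * (T 1) s := by
  filter_upwards [hT.le_mul (x := x) (M := ‖x‖) fun t => (le_abs_self _).trans (x.norm_coe_le_norm t),
    hT.mul_le (x := x) (M := -‖x‖) fun t => neg_le_of_abs_le (x.norm_coe_le_norm t)] with s h1 h2
  exact abs_le.2 ⟨by linarith, h1⟩

theorem IsPositiveOperator.norm_map_one {T : SpaceC →L[ℝ] SpaceL} (hT : IsPositiveOperator T) :
    ‖T 1‖ = ∫ s, (T 1) s ∂lebesgue01 := by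
  rw [norm_spaceL_eq]
  refine integral_congr_ae ?_
  filter_upwards [hT.map_one_nonneg] with s hs
  exact abs_of_nonneg hs

theorem IsPositiveOperator.norm_eq {T : SpaceC →L[ℝ] SpaceL} (hT : IsPositiveOperator T) :
    ‖T‖ = ∫ s, (T 1) s ∂lebesgue01 := by
  rw [← hT.norm_map_one]
  refine le_antisymm (T.opNorm_le_bound (norm_nonneg _) fun x => ?_) ?_
  · rw [hT.norm_map_one, norm_spaceL_eq, mul_comm, ← integral_const_mul]
    exact integral_mono_ae (L1.integrable_coeFn _).abs ((L1.integrable_coeFn _).const_mul _)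
      (hT.abs_apply_le x)
  · simpa using T.le_opNorm 1

/-! ### Compactness and the Fredholm alternative -/

/-- Arzelà–Ascoli: on the unit ball |Tx| ≤ T1, so a single integrable function controls the
oscillation of every G(Tx). -/
theorem IsPositiveOperator.isCompactOperator_green_comp {κ : ℝ} (hκ : 0 < κ)
    {T : SpaceC →L[ℝ] SpaceL} (hT : IsPositiveOperator T) :
    IsCompactOperator ((greenOperator κ hκ).comp T) := by
  set S := (greenOperator κ hκ).comp T with hS
  rw [← ContinuousLinearMap.coe_coe, isCompactOperator_iff_isCompact_closure_image_closedBall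
    (S : SpaceC →ₗ[ℝ] SpaceC) one_pos]
  -- The range of C is complete for uniform convergence on compact sets; the Hausdorff property
  -- makes it closed.
  have : T2Space (UniformOnFun (Icc (0 : ℝ) 1) ℝ {K | IsCompact K}) :=
    UniformOnFun.t2Space_of_covering (eq_univ_iff_forall.2 fun t =>
      mem_sUnion_of_mem (mem_singleton t) isCompact_singleton)
  have hcl : Topology.IsClosedEmbedding
      (UniformOnFun.ofFun {K : Set (Icc (0 : ℝ) 1) | IsCompact K} ∘
        (fun x : SpaceC => (x : Icc (0 : ℝ) 1 → ℝ))) :=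
    ⟨ContinuousMap.isUniformEmbedding_toUniformOnFunIsCompact.isEmbedding, by
      exact (ContinuousMap.isUniformEmbedding_toUniformOnFunIsCompact.isUniformInducing.isComplete_range).isClosed⟩
  refine ArzelaAscoli.isCompact_closure_of_isClosedEmbedding
    (𝔖 := {K : Set (Icc (0 : ℝ) 1) | IsCompact K}) (F := fun x : SpaceC => ⇑x)
    (fun K hK => hK) hcl ?_ ?_
  · intro K _
    refine Equicontinuous.equicontinuousOn (fun t₀ => ?_) K
    have hω := continuous_integral_abs_greenKernel_sub hκ (T 1) t₀
    rw [ContinuousAt] at hω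
    simp only [sub_self, abs_zero, zero_mul, integral_zero] at hω
    refine Metric.equicontinuousAt_of_continuity_modulus _ hω _ (Eventually.of_forall ?_)
    rintro t ⟨_, x, hx, rfl⟩
    have hx1 : ‖x‖ ≤ 1 := by simpa using hx
    simp only [Function.comp_apply]
    change dist (greenOperator κ hκ (T x) t₀) (greenOperator κ hκ (T x) t) ≤ _
    rw [dist_comm, Real.dist_eq, greenOperator_apply, greenOperator_apply,
      ← integral_sub (integrable_greenKernel_mul hκ t.2.1 _)
        (integrable_greenKernel_mul hκ t₀.2.1 _), ← Real.norm_eq_abs]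
    refine norm_integral_le_of_norm_le ?_ ?_
    · refine (L1.integrable_coeFn (T 1)).bdd_mul (c := 2)
        (((measurable_greenKernel κ t).sub (measurable_greenKernel κ t₀)).abs).aestronglyMeasurable
        (Eventually.of_forall fun s => ?_)
      rw [Real.norm_eq_abs, abs_abs]
      refine (abs_sub _ _).trans ?_
      linarith [abs_greenKernel_le_one hκ t.2.1 s, abs_greenKernel_le_one hκ t₀.2.1 s]
    · filter_upwards [hT.abs_apply_le x, hT.map_one_nonneg] with s hs h0
      rw [← sub_mul, Real.norm_eq_abs, abs_mul]
      exact mul_le_mul_of_nonneg_left (hs.trans (mul_le_of_le_one_left h0 hx1)) (abs_nonneg _)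
  · intro K _ t _
    refine ⟨Metric.closedBall 0 ‖S‖, isCompact_closedBall _ _, ?_⟩
    rintro _ ⟨x, hx, rfl⟩
    have hx1 : ‖x‖ ≤ 1 := by simpa using hx
    rw [mem_closedBall_zero_iff]
    exact ((S x).norm_coe_le_norm t).trans ((S.le_opNorm x).trans
      (mul_le_of_le_one_right (norm_nonneg _) hx1))

/-- Fredholm alternative for the integral form of the problem. -/
theorem isUniquelySolvable_of_injective {κ : ℝ} (hκ : 0 < κ) {P Q : SpaceC →L[ℝ] SpaceL}
    (hP : IsPositiveOperator P) (hQ : IsPositiveOperator Q)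
    (h : ∀ x : SpaceC, x + greenOperator κ hκ ((P - Q) x) = 0 → x = 0) :
    IsUniquelySolvable (-κ) (P - Q) := by
  set S : SpaceC →L[ℝ] SpaceC := (greenOperator κ hκ).comp (P - Q) with hS
  have hcomp : IsCompactOperator S := by
    rw [hS, ContinuousLinearMap.comp_sub]
    exact (hP.isCompactOperator_green_comp hκ).sub (hQ.isCompactOperator_green_comp hκ)
  -- An eigenvector of S for -1 is exactly a nonzero homogeneous solution.
  have hbij : Function.Bijective (algebraMap ℝ (SpaceC →L[ℝ] SpaceC) (-1) - S) := by
    rw [← ContinuousLinearMap.isUnit_iff_bijective, ← spectrum.mem_resolventSet_iff]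
    refine (hcomp.hasEigenvalue_or_mem_resolventSet (neg_ne_zero.2 one_ne_zero)).resolve_left ?_
    intro hev
    obtain ⟨x, hx⟩ := hev.exists_hasEigenvector
    refine hx.2 (h x ?_)
    have : S x = (-1 : ℝ) • x := hx.apply_eq_smul
    change x + S x = 0
    rw [this]
    simp
  have hbij' : Function.Bijective fun x : SpaceC => x + greenOperator κ hκ ((P - Q) x) := by
    have : (fun x : SpaceC => x + greenOperator κ hκ ((P - Q) x))
        = Neg.neg ∘ (algebraMap ℝ (SpaceC →L[ℝ] SpaceC) (-1) - S) := by
      funext x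
      simp [hS, Algebra.algebraMap_eq_smul_one, add_comm]
    rw [this]
    exact (Equiv.neg SpaceC).bijective.comp hbij
  intro f c
  simp only [isSolution_iff hκ]
  exact hbij'.existsUnique _

/-! ### Sufficiency: the homogeneous equation -/

theorem neg_sub_apply_le {P Q : SpaceC →L[ℝ] SpaceL} (hP : IsPositiveOperator P)
    (hQ : IsPositiveOperator Q) {x : SpaceC} {m M : ℝ} (hm : ∀ t, -m ≤ x t) (hM : ∀ t, x t ≤ M) :
    ∀ᵐ s ∂lebesgue01, -((P - Q) x) s ≤ m * (P 1) s + M * (Q 1) s := by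
  filter_upwards [hP.mul_le hm, hQ.le_mul hM, Lp.coeFn_sub (P x) (Q x)] with s h1 h2 h3
  rw [sub_apply, h3, Pi.sub_apply]
  linarith

theorem sub_apply_le {P Q : SpaceC →L[ℝ] SpaceL} (hP : IsPositiveOperator P)
    (hQ : IsPositiveOperator Q) {x : SpaceC} {m M : ℝ} (hm : ∀ t, -m ≤ x t) (hM : ∀ t, x t ≤ M) :
    ∀ᵐ s ∂lebesgue01, ((P - Q) x) s ≤ M * (P 1) s + m * (Q 1) s := by
  filter_upwards [hP.le_mul hM, hQ.mul_le hm, Lp.coeFn_sub (P x) (Q x)] with s h1 h2 h3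
  rw [sub_apply, h3, Pi.sub_apply]
  linarith

section Homogeneous

variable {κ : ℝ} {hκ : 0 < κ} {P Q : SpaceC →L[ℝ] SpaceL} {x : SpaceC}

theorem apply_eq_of_add_green_eq_zero {T : SpaceC →L[ℝ] SpaceL}
    (hx : x + greenOperator κ hκ (T x) = 0) (t : Icc (0 : ℝ) 1) :
    x t = -∫ s, greenKernel κ t s * (T x) s ∂lebesgue01 := by
  rw [← greenOperator_apply hκ, ← ContinuousMap.neg_apply, ← eq_neg_of_add_eq_zero_left hx]

theorem neg_add_green_eq_zero {T : SpaceC →L[ℝ] SpaceL}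
    (hx : x + greenOperator κ hκ (T x) = 0) : -x + greenOperator κ hκ (T (-x)) = 0 := by
  rw [map_neg, map_neg, ← neg_add, hx, neg_zero]

/-- At a positive maximum, 1 ≤ ∫ g·Q1 ≤ ∫ Q1 ≤ 1 for the kernel g. Equality forces (1 - g)·Q1 = 0,
and g < 1 then gives Q1 = 0 almost everywhere, a contradiction even when ‖Q‖ = 1. -/
theorem eq_zero_of_nonneg_of_add_green_eq_zero (hP : IsPositiveOperator P)
    (hQ : IsPositiveOperator Q) (hQ1 : ∫ s, (Q 1) s ∂lebesgue01 ≤ 1)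
    (hx : x + greenOperator κ hκ ((P - Q) x) = 0) (h0 : ∀ t, 0 ≤ x t) : x = 0 := by
  obtain ⟨t, -, ht⟩ := isCompact_univ.exists_isMaxOn univ_nonempty x.continuous.continuousOn
  have hmax : ∀ u, x u ≤ x t := fun u => ht (mem_univ u)
  by_contra hne
  have hpos : 0 < x t := by
    refine lt_of_le_of_ne (h0 t) fun h => hne ?_
    ext u
    exact le_antisymm ((hmax u).trans h.ge) (h0 u)
  have hint := integrable_greenKernel_mul hκ t.2.1 (Q 1)
  have h1 : 1 ≤ ∫ s, greenKernel κ t s * (Q 1) s ∂lebesgue01 := by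
    have : x t ≤ ∫ s, x t * (greenKernel κ t s * (Q 1) s) ∂lebesgue01 := by
      nth_rewrite 1 [apply_eq_of_add_green_eq_zero hx t]
      rw [← integral_neg]
      refine integral_mono_ae (integrable_greenKernel_mul hκ t.2.1 _).neg (hint.const_mul _) ?_
      filter_upwards [neg_sub_apply_le hP hQ (m := 0) (by simpa using h0) hmax] with s hs
      have := mul_le_mul_of_nonneg_left hs (greenKernel_nonneg κ t.2.1 s)
      linarith
    rw [integral_const_mul] at this
    exact (le_mul_iff_one_le_right hpos).1 this
  have hnn : 0 ≤ᵐ[lebesgue01] fun s => (Q 1) s - greenKernel κ t s * (Q 1) s := by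
    filter_upwards [hQ.map_one_nonneg] with s hs
    have := mul_nonneg (sub_nonneg.2 (greenKernel_lt_one hκ t.2.1 s).le) hs
    simp only [Pi.zero_apply]
    linarith
  have hz : ∫ s, ((Q 1) s - greenKernel κ t s * (Q 1) s) ∂lebesgue01 = 0 := by
    refine le_antisymm ?_ (integral_nonneg_of_ae hnn)
    rw [integral_sub (L1.integrable_coeFn _) hint]
    linarith
  rw [integral_eq_zero_iff_of_nonneg_ae hnn ((L1.integrable_coeFn _).sub hint)] at hz
  have : ∫ s, greenKernel κ t s * (Q 1) s ∂lebesgue01 = 0 := by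
    refine integral_eq_zero_of_ae ?_
    filter_upwards [hz] with s hs
    have h2 : (1 - greenKernel κ t s) * (Q 1) s = 0 := by
      simp only [Pi.zero_apply] at hs
      linarith
    rcases mul_eq_zero.1 h2 with h3 | h3
    · exact absurd h3 (sub_pos.2 (greenKernel_lt_one hκ t.2.1 s)).ne'
    · simp [h3]
  linarith

/-- Beyond t₂ the terms cancel because (t₁/t₂)^κ (t₂/s)^κ = (t₁/s)^κ. -/
theorem greenKernel_sub_mul {t₁ t₂ : ℝ} (h1 : 0 < t₁) (h12 : t₁ < t₂) (s : ℝ) :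
    greenKernel κ t₁ s - (t₁ / t₂) ^ κ * greenKernel κ t₂ s
      = (Ioc t₁ t₂).indicator (greenKernel κ t₁) s := by
  by_cases hs : s ∈ Ioc t₁ t₂
  · rw [indicator_of_mem hs, greenKernel, greenKernel, if_neg hs.2.not_gt]
    simp
  · rw [indicator_of_notMem hs]
    rw [mem_Ioc, not_and_or, not_lt, not_le] at hs
    rcases hs with hs | hs
    · rw [greenKernel, greenKernel, if_neg hs.not_gt, if_neg (hs.trans h12.le).not_gt]
      simp
    · have h2 := h1.trans h12
      rw [greenKernel, greenKernel, if_pos (h12.trans hs), if_pos hs,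
        ← Real.mul_rpow (div_nonneg h1.le h2.le) (div_nonneg h2.le (h2.trans hs).le),
        div_mul_div_cancel₀ h2.ne', sub_self]

/-- The combination x(t₁) - (t₁/t₂)^κ x(t₂) involves Tx on (t₁,t₂] only, and x(t₂) involves it on
(t₂,1] only, so the two bounds use disjoint masses. The extra term (t₁/t₂)^κ m > 0 makes the first
bound strict. -/
theorem exists_split_of_max_lt_min (hP : IsPositiveOperator P) (hQ : IsPositiveOperator Q)
    (hx : x + greenOperator κ hκ ((P - Q) x) = 0) {t₁ t₂ : Icc (0 : ℝ) 1} {m M : ℝ}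
    (hm0 : 0 < m) (hM0 : 0 < M)
    (hm : ∀ t, -m ≤ x t) (hM : ∀ t, x t ≤ M) (h1 : x t₁ = M) (h2 : x t₂ = -m)
    (h0 : 0 < (t₁ : ℝ)) (h12 : (t₁ : ℝ) < t₂) :
    ∃ p₁ p₂ q₁ q₂ : ℝ, 0 ≤ p₁ ∧ 0 ≤ p₂ ∧ 0 ≤ q₁ ∧ 0 ≤ q₂ ∧
      p₁ + p₂ ≤ ∫ s, (P 1) s ∂lebesgue01 ∧ q₁ + q₂ ≤ ∫ s, (Q 1) s ∂lebesgue01 ∧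
      M < m * p₁ + M * q₁ ∧ m ≤ M * p₂ + m * q₂ := by
  have hIP := L1.integrable_coeFn (P 1)
  have hIQ := L1.integrable_coeFn (Q 1)
  have hsum : ∀ T : SpaceC →L[ℝ] SpaceL, IsPositiveOperator T →
      (∫ s in Ioc (t₁ : ℝ) t₂, (T 1) s ∂lebesgue01) + ∫ s in Ioi (t₂ : ℝ), (T 1) s ∂lebesgue01
        ≤ ∫ s, (T 1) s ∂lebesgue01 := by
    intro T hT
    have hI := L1.integrable_coeFn (T 1)
    rw [← setIntegral_union (disjoint_left.2 fun s hs hs' => (hs.2.trans_lt hs').false)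
      measurableSet_Ioi hI.integrableOn hI.integrableOn]
    exact setIntegral_le_integral hI hT.map_one_nonneg
  refine ⟨∫ s in Ioc (t₁ : ℝ) t₂, (P 1) s ∂lebesgue01, ∫ s in Ioi (t₂ : ℝ), (P 1) s ∂lebesgue01,
    ∫ s in Ioc (t₁ : ℝ) t₂, (Q 1) s ∂lebesgue01, ∫ s in Ioi (t₂ : ℝ), (Q 1) s ∂lebesgue01,
    integral_nonneg_of_ae (ae_restrict_of_ae hP.map_one_nonneg),
    integral_nonneg_of_ae (ae_restrict_of_ae hP.map_one_nonneg),
    integral_nonneg_of_ae (ae_restrict_of_ae hQ.map_one_nonneg),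
    integral_nonneg_of_ae (ae_restrict_of_ae hQ.map_one_nonneg), hsum P hP, hsum Q hQ, ?_, ?_⟩
  · have hr : 0 < ((t₁ : ℝ) / t₂) ^ κ := Real.rpow_pos_of_pos (div_pos h0 (h0.trans h12)) _
    have hi1 := integrable_greenKernel_mul hκ t₁.2.1 ((P - Q) x)
    have hi2 := integrable_greenKernel_mul hκ t₂.2.1 ((P - Q) x)
    have heq : M + ((t₁ : ℝ) / t₂) ^ κ * m
        = ∫ s, (Ioc (t₁ : ℝ) t₂).indicator (greenKernel κ t₁) s * -((P - Q) x) s ∂lebesgue01 := by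
      have e1 := apply_eq_of_add_green_eq_zero hx t₁
      have e2 := apply_eq_of_add_green_eq_zero hx t₂
      rw [h1] at e1
      rw [h2] at e2
      calc M + ((t₁ : ℝ) / t₂) ^ κ * m
          = -∫ s, (greenKernel κ t₁ s * ((P - Q) x) s
              - ((t₁ : ℝ) / t₂) ^ κ * (greenKernel κ t₂ s * ((P - Q) x) s)) ∂lebesgue01 := by
            rw [integral_sub hi1 (hi2.const_mul _), integral_const_mul]
            linear_combination e1 - ((t₁ : ℝ) / t₂) ^ κ * e2
        _ = _ := by
            rw [← integral_neg]
            refine integral_congr_ae (Eventually.of_forall fun s => ?_)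
            simp only [← greenKernel_sub_mul h0 h12]
            ring
    have hle : M + ((t₁ : ℝ) / t₂) ^ κ * m
        ≤ ∫ s in Ioc (t₁ : ℝ) t₂, (m * (P 1) s + M * (Q 1) s) ∂lebesgue01 := by
      rw [heq, ← integral_indicator measurableSet_Ioc]
      refine integral_mono_ae ?_
        (((hIP.const_mul m).add (hIQ.const_mul M)).indicator measurableSet_Ioc) ?_
      · refine ((L1.integrable_coeFn ((P - Q) x)).neg).bdd_mul (c := 1)
          ((measurable_greenKernel κ t₁).indicator measurableSet_Ioc).aestronglyMeasurable
          (Eventually.of_forall fun s => ?_)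
        exact (norm_indicator_le_norm_self _ _).trans (abs_greenKernel_le_one hκ t₁.2.1 s)
      · filter_upwards [neg_sub_apply_le hP hQ hm hM, hP.map_one_nonneg, hQ.map_one_nonneg]
          with s hs hp hq
        by_cases hmem : s ∈ Ioc (t₁ : ℝ) t₂
        · simp only [indicator_of_mem hmem]
          exact (mul_le_mul_of_nonneg_left hs (greenKernel_nonneg κ t₁.2.1 s)).trans
            (mul_le_of_le_one_left (by positivity) (greenKernel_lt_one hκ t₁.2.1 s).le)
        · simp only [indicator_of_notMem hmem, zero_mul, le_refl]
    rw [integral_add (hIP.const_mul m).integrableOn (hIQ.const_mul M).integrableOn,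
      integral_const_mul, integral_const_mul] at hle
    linarith [mul_pos hr hm0]
  · have hle : m ≤ ∫ s in Ioi (t₂ : ℝ), (M * (P 1) s + m * (Q 1) s) ∂lebesgue01 := by
      have e2 := apply_eq_of_add_green_eq_zero hx t₂
      rw [h2, neg_inj] at e2
      nth_rewrite 1 [e2]
      rw [← integral_indicator measurableSet_Ioi]
      refine integral_mono_ae (integrable_greenKernel_mul hκ t₂.2.1 _)
        (((hIP.const_mul M).add (hIQ.const_mul m)).indicator measurableSet_Ioi) ?_
      filter_upwards [sub_apply_le hP hQ hm hM, hP.map_one_nonneg, hQ.map_one_nonneg]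
        with s hs hp hq
      by_cases hmem : s ∈ Ioi (t₂ : ℝ)
      · simp only [indicator_of_mem hmem]
        exact (mul_le_mul_of_nonneg_left hs (greenKernel_nonneg κ t₂.2.1 s)).trans
          (mul_le_of_le_one_left (by positivity) (greenKernel_lt_one hκ t₂.2.1 s).le)
      · have : greenKernel κ t₂ s = 0 := if_neg hmem
        simp only [indicator_of_notMem hmem, this, zero_mul, le_refl]
    rwa [integral_add (hIP.const_mul M).integrableOn (hIQ.const_mul m).integrableOn,
      integral_const_mul, integral_const_mul] at hle

/-- If q₂ < 1, eliminating m gives (1 - q₁)(1 - q₂) < p₁p₂ ≤ τp²/4, whereas the left side is at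
least 1 - τq. -/
theorem false_of_split_inequalities {p₁ p₂ q₁ q₂ τp τq m M : ℝ} (hM : 0 < M)
    (hp₁ : 0 ≤ p₁) (hp₂ : 0 ≤ p₂) (hq₁ : 0 ≤ q₁) (hq₂ : 0 ≤ q₂)
    (hp : p₁ + p₂ ≤ τp) (hq : q₁ + q₂ ≤ τq) (hτ : τp ^ 2 / 4 + τq ≤ 1)
    (h1 : M < m * p₁ + M * q₁) (h2 : m ≤ M * p₂ + m * q₂) : False := by
  have hpp : p₁ * p₂ ≤ τp ^ 2 / 4 := by
    have : (p₁ + p₂) ^ 2 ≤ τp ^ 2 := pow_le_pow_left₀ (by positivity) hp 2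
    nlinarith [sq_nonneg (p₁ - p₂)]
  have hq₂1 : q₂ ≤ 1 := by nlinarith [sq_nonneg τp]
  rcases hq₂1.lt_or_eq with hlt | rfl
  · have e1 : M * (1 - q₁) * (1 - q₂) < m * p₁ * (1 - q₂) :=
      mul_lt_mul_of_pos_right (by linarith) (by linarith)
    have e2 : m * (1 - q₂) * p₁ ≤ M * p₂ * p₁ := mul_le_mul_of_nonneg_right (by linarith) hp₁
    have e3 : M * ((1 - q₁) * (1 - q₂)) < M * (p₁ * p₂) := by linarith
    have e4 := lt_of_mul_lt_mul_left e3 hM.le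
    nlinarith [mul_nonneg hq₁ hq₂]
  · have hτp : τp ^ 2 ≤ 0 := by linarith
    have : τp = 0 := by simpa using le_antisymm hτp (sq_nonneg _)
    have hp0 : p₁ = 0 := by linarith
    have hq0 : q₁ = 0 := by nlinarith
    rw [hp0, hq0] at h1
    linarith

theorem eq_zero_of_add_green_eq_zero (hP : IsPositiveOperator P) (hQ : IsPositiveOperator Q)
    (hτ : (∫ s, (P 1) s ∂lebesgue01) ^ 2 / 4 + ∫ s, (Q 1) s ∂lebesgue01 ≤ 1)
    (hx : x + greenOperator κ hκ ((P - Q) x) = 0) : x = 0 := by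
  have hQ1 : ∫ s, (Q 1) s ∂lebesgue01 ≤ 1 := by
    nlinarith [sq_nonneg (∫ s, (P 1) s ∂lebesgue01)]
  obtain ⟨t₁, -, ht₁⟩ := isCompact_univ.exists_isMaxOn univ_nonempty x.continuous.continuousOn
  obtain ⟨t₂, -, ht₂⟩ := isCompact_univ.exists_isMinOn univ_nonempty x.continuous.continuousOn
  have hmax : ∀ u, x u ≤ x t₁ := fun u => ht₁ (mem_univ u)
  have hmin : ∀ u, x t₂ ≤ x u := fun u => ht₂ (mem_univ u)
  rcases le_or_gt 0 (x t₂) with hnn | hneg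
  · exact eq_zero_of_nonneg_of_add_green_eq_zero hP hQ hQ1 hx fun t => hnn.trans (hmin t)
  rcases le_or_gt (x t₁) 0 with hnp | hpos
  · refine neg_eq_zero.1 (eq_zero_of_nonneg_of_add_green_eq_zero hP hQ hQ1
      (neg_add_green_eq_zero hx) fun t => ?_)
    simpa using (hmax t).trans hnp
  exfalso
  -- Hence both extremal points are positive, as the ratio t₁/t₂ requires.
  have hx0 : x 0 = 0 := by
    rw [eq_neg_of_add_eq_zero_left hx, ContinuousMap.neg_apply, greenOperator_zero, neg_zero]
  have hpos_of : ∀ t : Icc (0 : ℝ) 1, x t ≠ 0 → 0 < (t : ℝ) := fun t ht =>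
    lt_of_le_of_ne t.2.1 fun h => ht (by rwa [show t = 0 from Subtype.ext h.symm])
  rcases lt_trichotomy (t₁ : ℝ) t₂ with h | h | h
  · obtain ⟨p₁, p₂, q₁, q₂, a, b, c, d, e, f, g, i⟩ := exists_split_of_max_lt_min hP hQ hx
      (m := -x t₂) (M := x t₁) (by linarith) hpos (by simpa using hmin) hmax rfl (by simp)
      (hpos_of t₁ hpos.ne') h
    exact false_of_split_inequalities hpos a b c d e f hτ g i
  · rw [Subtype.ext h] at hpos
    linarith
  · obtain ⟨p₁, p₂, q₁, q₂, a, b, c, d, e, f, g, i⟩ := exists_split_of_max_lt_min hP hQ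
      (neg_add_green_eq_zero hx) (t₁ := t₂) (t₂ := t₁)
      (m := x t₁) (M := -x t₂) hpos (by linarith) (by simpa using hmax) (by simpa using hmin)
      (by simp) (by simp) (hpos_of t₂ hneg.ne) h
    exact false_of_split_inequalities (by linarith) a b c d e f hτ g i

end Homogeneous

/-! ### Necessity: finite-rank counterexamples -/

theorem integral_spaceL_add (f g : SpaceL) :
    ∫ s, (f + g) s ∂lebesgue01 = ∫ s, f s ∂lebesgue01 + ∫ s, g s ∂lebesgue01 := by
  rw [← integral_add (L1.integrable_coeFn f) (L1.integrable_coeFn g)]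
  exact integral_congr_ae (Lp.coeFn_add f g)

theorem integral_spaceL_smul (c : ℝ) (f : SpaceL) :
    ∫ s, (c • f) s ∂lebesgue01 = c * ∫ s, f s ∂lebesgue01 := by
  rw [← integral_const_mul]
  exact integral_congr_ae (Lp.coeFn_smul c f)

/-- The rank one operator `x ↦ x(t) f`. -/
def evalSMul (t : Icc (0 : ℝ) 1) (f : SpaceL) : SpaceC →L[ℝ] SpaceL :=
  (ContinuousMap.evalCLM ℝ t).smulRight f

theorem evalSMul_apply (t : Icc (0 : ℝ) 1) (f : SpaceL) (x : SpaceC) :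
    evalSMul t f x = x t • f := rfl

theorem isPositiveOperator_evalSMul (t : Icc (0 : ℝ) 1) {c : ℝ} (hc : 0 ≤ c) {f : SpaceL}
    (hf : ∀ᵐ s ∂lebesgue01, 0 ≤ f s) : IsPositiveOperator (evalSMul t (c • f)) := by
  intro x hx
  rw [evalSMul_apply, smul_smul]
  filter_upwards [hf, Lp.coeFn_smul (x t * c) f] with s hs h
  rw [h]
  exact mul_nonneg (mul_nonneg (hx t) hc) hs

theorem IsPositiveOperator.add {S T : SpaceC →L[ℝ] SpaceL} (hS : IsPositiveOperator S)
    (hT : IsPositiveOperator T) : IsPositiveOperator (S + T) := by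
  intro x hx
  filter_upwards [hS x hx, hT x hx, Lp.coeFn_add (S x) (T x)] with s h1 h2 h3
  rw [add_apply, h3]
  exact add_nonneg h1 h2

/-- For the normalized indicator of (α,β], (Gu)(a) is the mean of the kernel over that interval and
inherits its bounds. -/
theorem exists_bump {κ : ℝ} (hκ : 0 < κ) {α β : ℝ} (hα : 0 ≤ α) (hαβ : α < β) (hβ : β ≤ 1) :
    ∃ u : SpaceL, (∀ᵐ s ∂lebesgue01, 0 ≤ u s) ∧ ∫ s, u s ∂lebesgue01 = 1 ∧
      ∀ (a : Icc (0 : ℝ) 1) (l h : ℝ),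
        (∀ s ∈ Ioc α β, l ≤ greenKernel κ a s ∧ greenKernel κ a s ≤ h) →
        l ≤ greenOperator κ hκ u a ∧ greenOperator κ hκ u a ≤ h := by
  set u : SpaceL := indicatorConstLp 1 (μ := lebesgue01) (s := Ioc α β) measurableSet_Ioc
    (measure_ne_top _ _) (β - α)⁻¹
  have hu : u =ᵐ[lebesgue01] (Ioc α β).indicator fun _ => (β - α)⁻¹ := indicatorConstLp_coeFn
  have hpos : 0 < (β - α)⁻¹ := inv_pos.2 (sub_pos.2 hαβ)
  have hnn : ∀ᵐ s ∂lebesgue01, 0 ≤ u s := by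
    filter_upwards [hu] with s hs
    rw [hs]
    exact indicator_nonneg (fun _ _ => hpos.le) _
  have hone : ∫ s, u s ∂lebesgue01 = 1 := by
    rw [integral_congr_ae hu, integral_indicator measurableSet_Ioc,
      Measure.restrict_restrict measurableSet_Ioc,
      inter_eq_left.2 (Ioc_subset_Icc_self.trans (Icc_subset_Icc hα hβ)), setIntegral_const,
      Real.volume_real_Ioc_of_le hαβ.le, smul_eq_mul, mul_inv_cancel₀ (sub_pos.2 hαβ).ne']
  have hI := L1.integrable_coeFn u
  refine ⟨u, hnn, hone, fun a l h hlh => ?_⟩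
  have hbd : ∀ᵐ s ∂lebesgue01,
      l * u s ≤ greenKernel κ a s * u s ∧ greenKernel κ a s * u s ≤ h * u s := by
    filter_upwards [hu, hnn] with s hs h0
    by_cases hmem : s ∈ Ioc α β
    · exact ⟨mul_le_mul_of_nonneg_right (hlh s hmem).1 h0,
        mul_le_mul_of_nonneg_right (hlh s hmem).2 h0⟩
    · rw [hs, indicator_of_notMem hmem]
      simp
  have hG := integrable_greenKernel_mul hκ a.2.1 u
  have h1 := integral_mono_ae (hI.const_mul l) hG (hbd.mono fun _ hs => hs.1)
  have h2 := integral_mono_ae hG (hI.const_mul h) (hbd.mono fun _ hs => hs.2)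
  rw [integral_const_mul, hone, mul_one] at h1 h2
  exact ⟨h1, h2⟩

/-- First ρ is taken close to 1, then n large to kill b ρⁿ. Here ρ will bound the diagonal values of
G on the bumps from below, and ρⁿ the off-diagonal one from above. -/
theorem exists_parameters {b q : ℝ} (h : 1 < b ^ 2 + q) :
    ∃ ρ : ℝ, 0 < ρ ∧ ρ < 1 ∧ ∃ n : ℕ, 1 ≤ n ∧ 1 < b ^ 2 * ρ ^ 2 - b * ρ ^ n + q * ρ := by
  have hc : Tendsto (fun ρ : ℝ => b ^ 2 * ρ ^ 2 + q * ρ) (𝓝[<] 1) (𝓝 (b ^ 2 + q)) := by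
    have : Continuous fun ρ : ℝ => b ^ 2 * ρ ^ 2 + q * ρ := by fun_prop
    simpa using (this.tendsto 1).mono_left nhdsWithin_le_nhds
  obtain ⟨ρ, hρ, hρ0, hρ1⟩ := ((hc.eventually_const_lt h).and
    (Ioo_mem_nhdsLT (zero_lt_one (α := ℝ)))).exists
  have hn : Tendsto (fun n : ℕ => b ^ 2 * ρ ^ 2 - b * ρ ^ n + q * ρ) atTop
      (𝓝 (b ^ 2 * ρ ^ 2 - b * 0 + q * ρ)) :=
    (((tendsto_pow_atTop_nhds_zero_of_lt_one hρ0.le hρ1).const_mul b).const_sub _).add_const _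
  obtain ⟨n, hn1, hn2⟩ := ((hn.eventually_const_lt (u := 1) (by linarith)).and (eventually_ge_atTop 1)).exists
  exact ⟨ρ, hρ0, hρ1, n, hn2, hn1⟩

theorem exists_two_bumps {κ : ℝ} (hκ : 0 < κ) {b q : ℝ} (hb : 0 ≤ b) (hq : 0 ≤ q)
    (h : 1 < b ^ 2 + q) :
    ∃ (a₁ a₂ : Icc (0 : ℝ) 1) (u₁ u₂ : SpaceL),
      (∀ᵐ s ∂lebesgue01, 0 ≤ u₁ s) ∧ (∀ᵐ s ∂lebesgue01, 0 ≤ u₂ s) ∧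
      ∫ s, u₁ s ∂lebesgue01 = 1 ∧ ∫ s, u₂ s ∂lebesgue01 = 1 ∧
      greenOperator κ hκ u₁ a₂ = 0 ∧
      1 < b ^ 2 * (greenOperator κ hκ u₁ a₁ * greenOperator κ hκ u₂ a₂)
        - b * greenOperator κ hκ u₂ a₁ + q * greenOperator κ hκ u₁ a₁ := by
  obtain ⟨ρ, hρ0, hρ1, n, hn, hF⟩ := exists_parameters h
  -- With r^κ = ρ, the bumps fill (r^(n+1), r^n] and (r, 1], and a₁, a₂ are their left ends. Since n
  -- ≥ 1, the first bump lies to the left of a₂, so Gu₁ vanishes there.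
  set r : ℝ := ρ ^ κ⁻¹ with hr
  have hr0 : 0 < r := Real.rpow_pos_of_pos hρ0 _
  have hr1 : r < 1 := Real.rpow_lt_one hρ0.le hρ1 (inv_pos.2 hκ)
  have hrκ : r ^ κ = ρ := Real.rpow_inv_rpow hρ0.le hκ.ne'
  have hrn0 : ∀ j : ℕ, 0 < r ^ j := fun j => pow_pos hr0 j
  have hrn1 : ∀ j : ℕ, r ^ j ≤ 1 := fun j => pow_le_one₀ hr0.le hr1.le
  have hlt : r ^ (n + 1) < r ^ n := pow_lt_pow_right_of_lt_one₀ hr0 hr1 n.lt_succ_self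
  have hrn : r ^ n ≤ r := pow_le_of_le_one hr0.le hr1.le (by omega)
  obtain ⟨u₁, h1nn, h1one, h1⟩ := exists_bump hκ (hrn0 (n + 1)).le hlt (hrn1 n)
  obtain ⟨u₂, h2nn, h2one, h2⟩ := exists_bump hκ hr0.le hr1 le_rfl
  let a₁ : Icc (0 : ℝ) 1 := ⟨r ^ (n + 1), (hrn0 _).le, hrn1 _⟩
  let a₂ : Icc (0 : ℝ) 1 := ⟨r, hr0.le, hr1.le⟩
  have g11 := h1 a₁ ρ 1 fun s hs => by
    have hs0 : 0 < s := (hrn0 _).trans hs.1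
    refine ⟨?_, (greenKernel_lt_one hκ a₁.2.1 s).le⟩
    rw [greenKernel, if_pos hs.1, ← hrκ]
    refine Real.rpow_le_rpow hr0.le ?_ hκ.le
    rw [le_div_iff₀ hs0]
    exact (mul_le_mul_of_nonneg_left hs.2 hr0.le).trans_eq (pow_succ' r n).symm
  have g22 := h2 a₂ ρ 1 fun s hs => by
    have hs0 : 0 < s := hr0.trans hs.1
    refine ⟨?_, (greenKernel_lt_one hκ a₂.2.1 s).le⟩
    rw [greenKernel, if_pos hs.1, ← hrκ]
    refine Real.rpow_le_rpow hr0.le ?_ hκ.le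
    rw [le_div_iff₀ hs0]
    exact mul_le_of_le_one_right hr0.le hs.2
  have g12 := h2 a₁ 0 (ρ ^ n) fun s hs => by
    have hs0 : 0 < s := hr0.trans hs.1
    refine ⟨greenKernel_nonneg κ a₁.2.1 s, ?_⟩
    rw [greenKernel, if_pos ((hlt.trans_le hrn).trans hs.1), ← hrκ, ← Real.rpow_natCast,
      ← Real.rpow_mul hr0.le, mul_comm κ, Real.rpow_mul hr0.le, Real.rpow_natCast]
    refine Real.rpow_le_rpow (div_nonneg a₁.2.1 hs0.le) ?_ hκ.le
    rw [div_le_iff₀ hs0]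
    exact (pow_succ r n).trans_le (mul_le_mul_of_nonneg_left hs.1.le (hrn0 n).le)
  have g21 := h1 a₂ 0 0 fun s hs => by
    have : greenKernel κ a₂ s = 0 := if_neg (hs.2.trans hrn).not_gt
    simp [this]
  refine ⟨a₁, a₂, u₁, u₂, h1nn, h2nn, h1one, h2one, le_antisymm g21.2 g21.1, ?_⟩
  have e1 : ρ ^ 2 ≤ greenOperator κ hκ u₁ a₁ * greenOperator κ hκ u₂ a₂ := by
    rw [sq]
    exact mul_le_mul g11.1 g22.1 hρ0.le (hρ0.le.trans g11.1)
  have e2 := mul_le_mul_of_nonneg_left e1 (sq_nonneg b)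
  have e3 := mul_le_mul_of_nonneg_left g12.2 hb
  have e4 := mul_le_mul_of_nonneg_left g11.1 hq
  linarith

theorem exists_not_isUniquelySolvable {κ : ℝ} (hκ : 0 < κ) {τp τq : ℝ} (hp : 0 ≤ τp)
    (hq : 0 ≤ τq) (h : 1 < τp ^ 2 / 4 + τq) :
    ∃ P Q : SpaceC →L[ℝ] SpaceL, IsPositiveOperator P ∧ IsPositiveOperator Q ∧
      ‖P‖ = τp ∧ ‖Q‖ = τq ∧ ¬ IsUniquelySolvable (-κ) (P - Q) := by
  obtain ⟨a₁, a₂, u₁, u₂, h1nn, h2nn, h1one, h2one, h21, hF⟩ :=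
    exists_two_bumps hκ (b := τp / 2) (q := τq) (by positivity) hq (by rw [div_pow]; linarith)
  set G := greenOperator κ hκ with hG
  -- The left side is the value at a₁ that the candidate x below takes; it must be 1. It is 0 at θ =
  -- 0 and exceeds 1 at θ = 1.
  obtain ⟨θ, ⟨hθ0, hθ1⟩, hθ⟩ : ∃ θ ∈ Icc (0 : ℝ) 1, (θ * (τp / 2)) ^ 2 * (G u₁ a₁ * G u₂ a₂)
      - θ * (τp / 2) * G u₂ a₁ + θ * τq * G u₁ a₁ = 1 := by
    refine intermediate_value_Icc (f := fun θ : ℝ => (θ * (τp / 2)) ^ 2 * (G u₁ a₁ * G u₂ a₂)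
      - θ * (τp / 2) * G u₂ a₁ + θ * τq * G u₁ a₁) zero_le_one
      (Continuous.continuousOn (by fun_prop)) ⟨?_, ?_⟩
    · simp
    · simpa using hF.le
  set p := θ * (τp / 2) with hpdef
  set q := θ * τq with hqdef
  have hp0 : 0 ≤ p := by positivity
  have hq0 : 0 ≤ q := by positivity
  have hpτ : 0 ≤ τp - 2 * p := by nlinarith
  have hqτ : 0 ≤ τq - q := by nlinarith
  -- The evaluations at 0 raise the norms to τp and τq without affecting the solution, as x(0) = 0.
  set P := evalSMul a₂ (p • u₁) + evalSMul a₁ (p • u₂) + evalSMul 0 ((τp - 2 * p) • u₁) with hP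
  set Q := evalSMul a₁ (q • u₁) + evalSMul 0 ((τq - q) • u₁) with hQ
  have hPpos : IsPositiveOperator P := ((isPositiveOperator_evalSMul a₂ hp0 h1nn).add
    (isPositiveOperator_evalSMul a₁ hp0 h2nn)).add (isPositiveOperator_evalSMul 0 hpτ h1nn)
  have hQpos : IsPositiveOperator Q :=
    (isPositiveOperator_evalSMul a₁ hq0 h1nn).add (isPositiveOperator_evalSMul 0 hqτ h1nn)
  refine ⟨P, Q, hPpos, hQpos, ?_, ?_, fun hus => ?_⟩
  · rw [hPpos.norm_eq]
    simp only [hP, add_apply, evalSMul_apply, ContinuousMap.one_apply, one_smul,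
      integral_spaceL_add, integral_spaceL_smul, h1one, h2one]
    ring
  · rw [hQpos.norm_eq]
    simp only [hQ, add_apply, evalSMul_apply, ContinuousMap.one_apply, one_smul,
      integral_spaceL_add, integral_spaceL_smul, h1one]
    ring
  -- This is -G(Tx) computed with x(a₁) = 1 and x(a₂) = -p·(Gu₂)(a₂); both values are then
  -- confirmed.
  · set x : SpaceC := -G ((-(p * (p * G u₂ a₂)) - q) • u₁ + p • u₂) with hx
    have hx0 : x 0 = 0 := by
      rw [hx, ContinuousMap.neg_apply, hG, greenOperator_zero, neg_zero]
    have hx1 : x a₁ = 1 := by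
      rw [hx]
      simp only [map_add, map_smul, ContinuousMap.neg_apply, ContinuousMap.add_apply,
        ContinuousMap.smul_apply, smul_eq_mul]
      linear_combination hθ
    have hx2 : x a₂ = -(p * G u₂ a₂) := by
      rw [hx]
      simp only [map_add, map_smul, ContinuousMap.neg_apply, ContinuousMap.add_apply,
        ContinuousMap.smul_apply, smul_eq_mul, h21]
      ring
    have hT : (P - Q) x = (-(p * (p * G u₂ a₂)) - q) • u₁ + p • u₂ := by
      simp only [hP, hQ, sub_apply, add_apply, evalSMul_apply, hx0, hx1, hx2]
      module
    have hsol : IsSolution (-κ) (P - Q) 0 0 x := by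
      rw [isSolution_iff hκ, hT]
      simp [hx, hG]
    have hzero : IsSolution (-κ) (P - Q) 0 0 0 := by
      rw [isSolution_iff hκ]
      simp
    have := (hus 0 0).unique hsol hzero
    rw [this] at hx1
    simp at hx1

theorem le_two_mul_sqrt_iff {τp τq : ℝ} (hp : 0 ≤ τp) :
    (τq ≤ 1 ∧ τp ≤ 2 * √(1 - τq)) ↔ τp ^ 2 / 4 + τq ≤ 1 := by
  have key : τp ≤ 2 * √(1 - τq) ↔ τp / 2 ≤ √(1 - τq) := by
    constructor <;> intro h <;> linarith
  constructor
  · rintro ⟨h1, h2⟩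
    rw [key, Real.le_sqrt (by positivity) (by linarith)] at h2
    linarith [div_pow τp 2 2]
  · intro h
    have h1 : τq ≤ 1 := by nlinarith [sq_nonneg τp]
    refine ⟨h1, ?_⟩
    rw [key]
    refine Real.le_sqrt_of_sq_le ?_
    linarith [div_pow τp 2 2]

end

theorem mainTheorem2 (k : ℝ) (hk : k < 0) (τPlus τMinus : ℝ) (hPlus : 0 ≤ τPlus)
    (hMinus : 0 ≤ τMinus) :
    (∀ TPlus TMinus : SpaceC →L[ℝ] SpaceL,
      IsPositiveOperator TPlus → IsPositiveOperator TMinus →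
      ‖TPlus‖ = τPlus → ‖TMinus‖ = τMinus →
      IsUniquelySolvable k (TPlus - TMinus)) ↔
    (τMinus ≤ 1 ∧ τPlus ≤ 2 * Real.sqrt (1 - τMinus)) := by
  obtain ⟨κ, rfl⟩ : ∃ κ, k = -κ := ⟨-k, (neg_neg k).symm⟩
  have hκ : 0 < κ := neg_lt_zero.1 hk
  rw [le_two_mul_sqrt_iff hPlus]
  constructor
  · intro h
    by_contra hlt
    obtain ⟨P, Q, hP, hQ, hPn, hQn, hns⟩ :=
      exists_not_isUniquelySolvable hκ hPlus hMinus (not_le.1 hlt)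
    exact hns (h P Q hP hQ hPn hQn)
  · rintro h P Q hP hQ rfl rfl
    rw [hP.norm_eq, hQ.norm_eq] at h
    exact isUniquelySolvable_of_injective hκ hP hQ fun x hx => eq_zero_of_add_green_eq_zero hP hQ h hx
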